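/- Let $\boldsymbol\alpha=(\alpha_j)_{j\in\mathbb Z}$ be a finitely supported real mask and let $\mathcal S_{\boldsymbol\alpha}(\boldsymbol c)_j=\sum_{k\in\mathbb Z}\alpha_{j-2k}c_k$ be the associated linear univariate subdivision scheme, acting on real sequences $\boldsymbol c=(c_k)_{k\in\mathbb Z}$. The scheme is called convergent if for every real sequence $\boldsymbol c$ there is a continuous function $f:\mathbb R\to\mathbb R$ such that, for every closed bounded interval $I$, $\sup_{j\in\mathbb Z\cap 2^nI}|\mathcal S_{\boldsymbol\alpha}^n(\boldsymbol c)_j-f(2^{-n}j)|\to0$ as $n\to\infty$, and if $f\not\equiv0$ for at least one $\boldsymbol c$. For $\xi>0$, let $\widetilde{\boldsymbol\alpha}=\widetilde{\boldsymbol\alpha}(\xi)$ be the following approximating mask. Its odd elements are those of $\boldsymbol\alpha$: $\widetilde\alpha_{2k+1}=\alpha_{2k+1}$. Its even elements are the coefficients of the Laurent polynomial $\sum_{k}\widetilde\alpha_{2k}z^k$ obtained from the symbol $(\boldsymbol\alpha\downarrow2)(z)=\sum_k\alpha_{2k}z^k$ by replacing each zero $r$ with $|r|=1$ by $(1+\xi)r$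 (counting multiplicities), keeping all other zeros, and normalizing so that the value at $z=1$ is $1$. That is, if $(\boldsymbol\alpha\downarrow2)(z)=z^{-N}p(z)$ with a polynomial $p$ whose multiset of complex zeros is $\Lambda$, then $$\sum_{k}\widetilde\alpha_{2k}z^k=z^{-N}\,C_\xi\prod_{r\in\Lambda,\ |r|\ne1}(z-r)\prod_{r\in\Lambda,\ |r|=1}\bigl(z-(1+\xi)r\bigr),$$ where the constant $C_\xi$ is chosen so that the right-hand side equals $1$ at $z=1$. (This does not depend on the choice of $N$, and $\widetilde{\boldsymbol\alpha}$ is again real and finitely supported.) If $\mathcal S_{\boldsymbol\alpha}$ is convergent, then there is $\xi_0>0$ such that $\mathcal S_{\widetilde{\boldsymbol\alpha}(\xi)}$ is convergent for every $\xi\in(0,\xi_0)$. -/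

import Mathlib

open Polynomial

noncomputable section

namespace Subdivision

/-- The polynomial `∏_{r ∈ Λ \ 𝕋} (z - r) * ∏_{r ∈ Λ ∩ 𝕋} (z - (1 + ξ) r)`, where `Λ` is the multiset
of zeros of `p` and `𝕋` is the unit circle. -/
def displaced (p : ℂ[X]) (ξ : ℝ) : ℂ[X] :=
  (p.roots.map fun r : ℂ => X - C (if ‖r‖ = 1 then (1 + (ξ : ℂ)) * r else r)).prod

/-- The reversible approximation of `p` with parameter `ξ` (the reciprocal of the pseudo-reverse of
`p`): the zeros of `p` of modulus one are multiplied by `1 + ξ`, and the leading constant is chosen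
such that the value at `1` is `1`. -/
def approxPoly (p : ℂ[X]) (ξ : ℝ) : ℂ[X] :=
  C ((displaced p ξ).eval 1)⁻¹ * displaced p ξ

/-- The even elements `α ↓ 2` of a mask. -/
def evenPart (α : ℤ →₀ ℝ) : ℤ →₀ ℝ :=
  α.comapDomain (fun k : ℤ => 2 * k) (fun _ _ _ _ h => by simpa using h)

/-- A power `N` such that `z ^ N * ∑ k, a k * z ^ k` is a polynomial in `z`. -/
def shiftExp (a : ℤ →₀ ℝ) : ℕ := a.support.sup Int.natAbs

/-- The symbol `∑ k, a k * z ^ k` (a Laurent polynomial) multiplied by `z ^ N`, `N = shiftExp a`. -/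
def symbolPoly (a : ℤ →₀ ℝ) : ℝ[X] :=
  ∑ k ∈ a.support, monomial (k + shiftExp a).toNat (a k)

/-- The complex coefficient of `z ^ k` in the reversible approximation of the symbol of `a`.
The symbol is multiplied by `z ^ N` to make it a polynomial, and the result is divided by `z ^ N`
again; this only adds or removes zeros at the origin, which the approximation does not move. -/
def approxCoeff (a : ℤ →₀ ℝ) (ξ : ℝ) (k : ℤ) : ℂ :=
  if 0 ≤ k + shiftExp a then
    (approxPoly ((symbolPoly a).map (algebraMap ℝ ℂ)) ξ).coeff (k + shiftExp a).toNat
  else 0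

lemma displaced_map_conj (p : ℝ[X]) (ξ : ℝ) :
    (displaced (p.map (algebraMap ℝ ℂ)) ξ).map (starRingEnd ℂ) =
      displaced (p.map (algebraMap ℝ ℂ)) ξ := by
  set q := p.map (algebraMap ℝ ℂ) with hq
  have hqc : q.map (starRingEnd ℂ) = q := by
    rw [hq, Polynomial.map_map]
    congr 1
    ext x
    simp
  have hroots : q.roots.map (starRingEnd ℂ) = q.roots := by
    have h := Polynomial.roots_map_of_injective_of_card_eq_natDegree
      (p := q) (f := starRingEnd ℂ) (RingHom.injective _)
      IsAlgClosed.card_roots_eq_natDegree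
    rwa [hqc] at h
  unfold displaced
  rw [← Polynomial.coe_mapRingHom, map_multiset_prod, Multiset.map_map]
  conv_rhs => rw [← hroots, Multiset.map_map]
  congr 1
  apply Multiset.map_congr rfl
  intro r _
  by_cases h : ‖r‖ = 1 <;> simp [h]

/-- The coefficients of the approximation of a real symbol are real, so that the real part taken in
`approxMask` loses nothing. -/
theorem approxCoeff_im (a : ℤ →₀ ℝ) (ξ : ℝ) (k : ℤ) : (approxCoeff a ξ k).im = 0 := by
  unfold approxCoeff
  split_ifs with h
  · have hd := displaced_map_conj (symbolPoly a) ξ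
    set d := displaced ((symbolPoly a).map (algebraMap ℝ ℂ)) ξ with hdd
    have hc : ∀ n, starRingEnd ℂ (d.coeff n) = d.coeff n := fun n => by
      conv_rhs => rw [← hd]
      simp
    have he : starRingEnd ℂ (d.eval 1) = d.eval 1 := by
      have := Polynomial.eval_map_apply (starRingEnd ℂ) (p := d) 1
      rw [hd, map_one] at this
      exact this.symm
    unfold approxPoly
    rw [← Complex.conj_eq_iff_im, ← hdd, coeff_C_mul, map_mul, map_inv₀, he, hc]
  · simp

lemma approxMask_support (α : ℤ →₀ ℝ) (ξ : ℝ) :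
    (Function.support fun j : ℤ =>
      if Even j then (approxCoeff (evenPart α) ξ (j / 2)).re else α j).Finite := by
  set N : ℤ := (shiftExp (evenPart α) : ℤ)
  set P := approxPoly ((symbolPoly (evenPart α)).map (algebraMap ℝ ℂ)) ξ with hP
  refine ((α.support.finite_toSet).union (Set.finite_Icc (-2 * N)
    (2 * (P.natDegree : ℤ) + 1))).subset ?_
  intro j hj
  rw [Function.mem_support] at hj
  by_cases he : Even j
  · right
    rw [if_pos he] at hj
    have h0 : approxCoeff (evenPart α) ξ (j / 2) ≠ 0 := fun h => hj (by simp [h])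
    unfold approxCoeff at h0
    split_ifs at h0 with h
    · have := Polynomial.le_natDegree_of_ne_zero h0
      rw [← hP] at this
      constructor <;> omega
    · exact absurd rfl h0
  · left
    rw [if_neg he] at hj
    simpa using hj

/-- The approximating mask of `α` with parameter `ξ`: its even elements are the coefficients of the
reversible approximation of the symbol of `α ↓ 2`, its odd elements are those of `α`. -/
def approxMask (α : ℤ →₀ ℝ) (ξ : ℝ) : ℤ →₀ ℝ :=
  Finsupp.ofSupportFinite
    (fun j : ℤ => if Even j then (approxCoeff (evenPart α) ξ (j / 2)).re else α j)
    (approxMask_support α ξ)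

/-- The subdivision (refinement) operator with mask `α`. -/
def subdivide (α : ℤ →₀ ℝ) (c : ℤ → ℝ) : ℤ → ℝ :=
  fun j => ∑ᶠ k : ℤ, α (j - 2 * k) * c k

/-- `f` is the limit function of the scheme with mask `α` from the initial data `c`: it is continuous
and the refined values on the grids `2 ^ (-n) ℤ` converge to it, uniformly on every bounded closed
interval. -/
def IsLimitFunction (α : ℤ →₀ ℝ) (c : ℤ → ℝ) (f : ℝ → ℝ) : Prop :=
  Continuous f ∧ ∀ a b ε : ℝ, 0 < ε → ∃ n₀ : ℕ, ∀ n ≥ n₀, ∀ j : ℤ,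
    (j : ℝ) / 2 ^ n ∈ Set.Icc a b → |(subdivide α)^[n] c j - f ((j : ℝ) / 2 ^ n)| < ε

/-- (Uniform) convergence of a subdivision scheme: every initial sequence has a continuous limit
function, and some initial sequence has a limit function that is not identically zero. -/
def IsConvergent (α : ℤ →₀ ℝ) : Prop :=
  (∀ c : ℤ → ℝ, ∃ f : ℝ → ℝ, IsLimitFunction α c f) ∧
    ∃ (c : ℤ → ℝ) (f : ℝ → ℝ), IsLimitFunction α c f ∧ f ≠ 0

end Subdivision

end

/-!
If a convergent scheme has the impulse limit `φ`, then `φ` is uniformly continuous, so the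
differences of consecutive values refined from the unit impulse become uniformly small. Conversely,
if the scheme reproduces constants, differences of initial data are multiplied in `L` steps by at
most a constant, depending only on the support of the mask, times the largest difference of the
impulse values at level `L`. Once this factor is at most `1 / 2`, differences decay geometrically
and the refined values converge uniformly.

For a fixed `L` the last condition involves finitely many entries, each depending continuously on
the mask. So, among the masks with support in a fixed interval that reproduce constants, convergence
is an open condition. The approximating mask reproduces constants by its normalization at `z = 1`,
its support does not leave the smallest interval `[-N, N]` containing that of the original mask, and
it tends to the original mask as `ξ → 0`.
-/

namespace Subdivision

open Filter Topology
open scoped NNReal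

lemma lipschitzWith_of_dist_succ_le {E : Type*} [PseudoMetricSpace E] {c : ℤ → E} {K : ℝ≥0}
    (h : ∀ k, dist (c k) (c (k + 1)) ≤ K) : LipschitzWith K c := by
  have ordered : ∀ a b : ℤ, a ≤ b → dist (c a) (c b) ≤ K * (b - a : ℝ) := fun a b hab => by
    induction b, hab using Int.leInduction with
    | base => simp
    | succ b _ ih =>
      calc dist (c a) (c (b + 1)) ≤ K * (b - a : ℝ) + K :=
            (dist_triangle _ (c b) _).trans (add_le_add ih (h b))
        _ = K * (((b + 1 : ℤ) : ℝ) - a) := by push_cast; ring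
  refine LipschitzWith.of_dist_le_mul fun a b => ?_
  rw [Int.dist_eq]
  rcases le_total a b with hab | hab
  · rw [abs_sub_comm, abs_of_nonneg (sub_nonneg.2 (Int.cast_le.2 hab))]
    exact ordered a b hab
  · rw [dist_comm, abs_of_nonneg (sub_nonneg.2 (Int.cast_le.2 hab))]
    exact ordered b a hab

lemma eventually_lipschitzWith_of_tendsto {ι E : Type*} [PseudoMetricSpace E] {l : Filter ι}
    {v : ι → ℤ → E} {w : ℤ → E} {e : E} {R : ℤ} {D : ℝ≥0} (hv : Tendsto v l (𝓝 w))
    (hR : ∀ᶠ t in l, ∀ j, R < |j| → v t j = e)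
    (hw : ∀ j, dist (w j) (w (j + 1)) < D) : ∀ᶠ t in l, LipschitzWith D (v t) := by
  rw [tendsto_pi_nhds] at hv
  have inside : ∀ᶠ t in l, ∀ j ∈ Finset.Icc (-(R + 1)) (R + 1), dist (v t j) (v t (j + 1)) < D := by
    rw [eventually_all_finset]
    exact fun j _ => ((hv j).dist (hv (j + 1))).eventually (gt_mem_nhds (hw j))
  filter_upwards [inside, hR] with t ht hRt
  refine lipschitzWith_of_dist_succ_le fun j => ?_
  by_cases hj : |j| ≤ R + 1
  · exact (ht j (Finset.mem_Icc.2 (abs_le.1 hj))).le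
  · have hj₁ : R < |j + 1| := by rw [abs_le, not_and_or] at hj; rw [lt_abs]; omega
    rw [hRt j (by omega), hRt (j + 1) hj₁, dist_self]
    exact D.coe_nonneg

lemma dist_floor_le_one {x y : ℝ} (h : |x - y| < 1) : dist ⌊x⌋ ⌊y⌋ ≤ 1 := by
  obtain ⟨hyx, hxy⟩ := abs_lt.1 h
  have upper : ⌊x⌋ ≤ ⌊y⌋ + 1 := by
    rw [← Int.floor_add_one]; exact Int.floor_le_floor (by linarith)
  have lower : ⌊y⌋ ≤ ⌊x⌋ + 1 := by
    rw [← Int.floor_add_one]; exact Int.floor_le_floor (by linarith)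
  rw [Int.dist_eq']
  exact_mod_cast abs_le.2 ⟨by omega, by omega⟩

lemma floor_two_pow_succ_mul_ediv_two (n : ℕ) (x : ℝ) :
    ⌊2 ^ (n + 1) * x⌋ / 2 = ⌊2 ^ n * x⌋ := by
  have h := Int.floor_div_natCast ((2 : ℝ) ^ (n + 1) * x) 2
  rw [show (2 : ℝ) ^ (n + 1) * x / (2 : ℕ) = 2 ^ n * x by push_cast; ring] at h
  exact_mod_cast h.symm

lemma tendsto_const_div_two_pow (t : ℝ) : Tendsto (fun n : ℕ => t / 2 ^ n) atTop (𝓝 0) :=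
  tendsto_const_nhds.div_atTop (tendsto_pow_atTop_atTop_of_one_lt one_lt_two)

lemma tendsto_floor_two_pow_mul_div (x : ℝ) :
    Tendsto (fun n : ℕ => (⌊2 ^ n * x⌋ : ℝ) / 2 ^ n) atTop (𝓝 x) := by
  rw [tendsto_iff_dist_tendsto_zero]
  refine squeeze_zero (fun _ => dist_nonneg) (fun n => ?_) (tendsto_const_div_two_pow 1)
  have hp : (0 : ℝ) < 2 ^ n := by positivity
  have hfl : |(⌊2 ^ n * x⌋ : ℝ) - 2 ^ n * x| ≤ 1 :=
    abs_le.2 ⟨by linarith [Int.lt_floor_add_one (2 ^ n * x)],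
      by linarith [Int.floor_le (2 ^ n * x)]⟩
  have hscale : (⌊2 ^ n * x⌋ : ℝ) / 2 ^ n - x = (⌊2 ^ n * x⌋ - 2 ^ n * x) / 2 ^ n := by
    rw [sub_div, mul_div_cancel_left₀ _ hp.ne']
  rw [Real.dist_eq, hscale, abs_div, abs_of_pos hp]
  gcongr

lemma continuous_of_dyadic_step_approx {E : Type*} [PseudoMetricSpace E] {u : ℕ → ℤ → E}
    {f : ℝ → E} {a : ℕ → ℝ≥0} {b : ℕ → ℝ} (hu : ∀ n, LipschitzWith (a n) (u n))
    (ha : Tendsto a atTop (𝓝 0)) (hf : ∀ n x, dist (u n ⌊2 ^ n * x⌋) (f x) ≤ b n)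
    (hb : Tendsto b atTop (𝓝 0)) : Continuous f := by
  rw [Metric.continuous_iff]
  intro x ε hε
  have htotal : Tendsto (fun n => b n + a n + b n) atTop (𝓝 0) := by
    simpa using (hb.add (NNReal.tendsto_coe.2 ha)).add hb
  obtain ⟨n, hn⟩ := (htotal.eventually (gt_mem_nhds hε)).exists
  have hp : (0 : ℝ) < 2 ^ n := by positivity
  refine ⟨1 / 2 ^ n, by positivity, fun y hy => lt_of_le_of_lt ?_ hn⟩
  have hfl : dist ⌊2 ^ n * y⌋ ⌊2 ^ n * x⌋ ≤ 1 := dist_floor_le_one <| by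
    rw [← mul_sub, abs_mul, abs_of_pos hp, mul_comm]
    rwa [Real.dist_eq, lt_div_iff₀ hp] at hy
  calc dist (f y) (f x) ≤ dist (f y) (u n ⌊2 ^ n * y⌋) +
        dist (u n ⌊2 ^ n * y⌋) (u n ⌊2 ^ n * x⌋) + dist (u n ⌊2 ^ n * x⌋) (f x) :=
        dist_triangle4 _ _ _ _
    _ ≤ b n + a n + b n := by
        refine add_le_add_three (dist_comm (f y) _ ▸ hf n y) ?_ (hf n x)
        exact ((hu n).dist_le_mul _ _).trans (mul_le_of_le_one_right (a n).coe_nonneg hfl)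

lemma exists_continuous_dyadic_limit {E : Type*} [PseudoMetricSpace E] [CompleteSpace E]
    {u : ℕ → ℤ → E} {K ρ : ℝ≥0} {A : ℝ} (hρ : ρ < 1)
    (hu : ∀ n, LipschitzWith (K * ρ ^ n) (u n))
    (hstep : ∀ n j, dist (u n (j / 2)) (u (n + 1) j) ≤ A * ρ ^ n) :
    ∃ f : ℝ → E, Continuous f ∧
      ∀ n (j : ℤ), dist (u n j) (f ((j : ℝ) / 2 ^ n)) ≤ A * ρ ^ n / (1 - ρ) := by
  have hρ' : (ρ : ℝ) < 1 := hρ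
  have hgeom : ∀ (x : ℝ) n,
      dist (u n ⌊2 ^ n * x⌋) (u (n + 1) ⌊2 ^ (n + 1) * x⌋) ≤ A * (ρ : ℝ) ^ n := fun x n => by
    simpa only [floor_two_pow_succ_mul_ediv_two] using hstep n ⌊2 ^ (n + 1) * x⌋
  choose f hf using fun x => cauchySeq_tendsto_of_complete
    (cauchySeq_of_le_geometric (ρ : ℝ) A hρ' (hgeom x))
  have herr : ∀ n (x : ℝ), dist (u n ⌊2 ^ n * x⌋) (f x) ≤ A * ρ ^ n / (1 - ρ) := fun n x =>
    dist_le_of_le_geometric_of_tendsto (ρ : ℝ) A hρ' (hgeom x) (hf x) n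
  refine ⟨f, continuous_of_dyadic_step_approx hu ?_ herr ?_, fun n j => ?_⟩
  · simpa using (NNReal.tendsto_pow_atTop_nhds_zero_of_lt_one hρ).const_mul K
  · simpa using ((tendsto_pow_atTop_nhds_zero_of_lt_one ρ.coe_nonneg hρ').const_mul A).div_const
      (1 - (ρ : ℝ))
  · have hp : (2 : ℝ) ^ n ≠ 0 := by positivity
    simpa only [mul_div_cancel₀ _ hp, Int.floor_intCast] using herr n ((j : ℝ) / 2 ^ n)

lemma exists_geometric_bound_of_add_eq_half {a : ℕ → ℝ≥0} {L : ℕ} (hL : L ≠ 0)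
    (h : ∀ n, a (n + L) = a n / 2) : ∃ K ρ : ℝ≥0, ρ < 1 ∧ ∀ n, a n ≤ K * ρ ^ n := by
  obtain ⟨ρ, hρL⟩ : ∃ ρ : ℝ≥0, ρ ^ L = 2⁻¹ := ⟨_, NNReal.rpow_inv_natCast_pow 2⁻¹ hL⟩
  have hρ0 : 0 < ρ := pos_of_ne_zero fun h0 => by simp [h0, hL] at hρL
  have hρ1 : ρ < 1 := (pow_lt_one_iff hL).1 (hρL ▸ inv_lt_one_of_one_lt₀ one_lt_two)
  refine ⟨∑ i ∈ Finset.range L, a i / ρ ^ i, ρ, hρ1, fun n => ?_⟩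
  induction n using Nat.strong_induction_on with
  | _ n ih =>
    rcases lt_or_ge n L with hn | hn
    · rw [← div_le_iff₀ (pow_pos hρ0 n)]
      exact Finset.single_le_sum_of_canonicallyOrdered (f := fun i => a i / ρ ^ i)
        (Finset.mem_range.2 hn)
    · obtain ⟨m, rfl⟩ := Nat.exists_eq_add_of_le' hn
      rw [h, pow_add, hρL, ← mul_assoc, ← div_eq_mul_inv]
      gcongr
      exact ih m (by omega)

variable {β : ℤ →₀ ℝ}

lemma shiftExp_le_iff {N : ℕ} : shiftExp β ≤ N ↔ ∀ i, β i ≠ 0 → |i| ≤ N := by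
  simp only [shiftExp, Finset.sup_le_iff, Finsupp.mem_support_iff, Int.abs_eq_natAbs,
    Nat.cast_le]

lemma abs_le_shiftExp {i : ℤ} (hi : β i ≠ 0) : |i| ≤ shiftExp β :=
  shiftExp_le_iff.1 le_rfl i hi

lemma subdivide_eq_sum {j : ℤ} {F : Finset ℤ} (hF : ∀ k, β (j - 2 * k) ≠ 0 → k ∈ F)
    (c : ℤ → ℝ) : subdivide β c j = ∑ k ∈ F, β (j - 2 * k) * c k :=
  finsum_eq_sum_of_support_subset _ fun k hk => hF k (left_ne_zero_of_mul hk)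

lemma mem_Icc_of_apply_ne_zero {N : ℕ} (hN : shiftExp β ≤ N) {j k : ℤ}
    (hk : β (j - 2 * k) ≠ 0) : k ∈ Finset.Icc (-(|j| + N)) (|j| + N) := by
  have hjk := abs_le.1 (shiftExp_le_iff.1 hN _ hk)
  have hj := abs_le.1 (le_refl |j|)
  rw [Finset.mem_Icc]
  omega

variable (β) in
/-- The subdivision operator as a linear map, so that linear combinations of initial data can be
refined termwise. -/
noncomputable def subdivideₗ : (ℤ → ℝ) →ₗ[ℝ] (ℤ → ℝ) where
  toFun := subdivide β
  map_add' c d := by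
    ext j
    simp only [Pi.add_apply, subdivide_eq_sum fun _ => mem_Icc_of_apply_ne_zero le_rfl, mul_add,
      Finset.sum_add_distrib]
  map_smul' t c := by
    ext j
    simp only [Pi.smul_apply, smul_eq_mul, RingHom.id_apply,
      subdivide_eq_sum fun _ => mem_Icc_of_apply_ne_zero le_rfl, Finset.mul_sum, mul_left_comm]

lemma subdivideₗ_pow_apply (n : ℕ) (c : ℤ → ℝ) :
    (subdivideₗ β ^ n) c = (subdivide β)^[n] c := by
  rw [Module.End.pow_apply]; rfl

lemma subdivide_shift (c : ℤ → ℝ) (j k : ℤ) :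
    subdivide β (fun m => c (m + k)) j = subdivide β c (j + 2 * k) := by
  rw [subdivide, subdivide,
    ← finsum_comp_equiv (Equiv.addRight k) (f := fun m => β (j + 2 * k - 2 * m) * c m)]
  refine finsum_congr fun m => ?_
  simp only [Equiv.coe_addRight, mul_add, add_sub_add_right_eq_sub]

lemma iterate_subdivide_shift (n : ℕ) (c : ℤ → ℝ) (j k : ℤ) :
    (subdivide β)^[n] (fun m => c (m + k)) j = (subdivide β)^[n] c (j + 2 ^ n * k) := by
  induction n generalizing c k with
  | zero => simp
  | succ n ih =>
    have hstep : subdivide β (fun m => c (m + k)) = fun m => subdivide β c (m + 2 * k) :=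
      funext fun m => subdivide_shift c m k
    rw [Function.iterate_succ_apply, Function.iterate_succ_apply, hstep, ih, pow_succ, mul_assoc]

lemma iterate_subdivide_eq_zero {c : ℤ → ℝ} {n : ℕ} {j : ℤ}
    (h : ∀ k, |j - 2 ^ n * k| ≤ (2 ^ n - 1) * shiftExp β → c k = 0) :
    (subdivide β)^[n] c j = 0 := by
  induction n generalizing j with
  | zero => exact h j (by simp)
  | succ n ih =>
    rw [Function.iterate_succ_apply']
    refine finsum_eq_zero_of_forall_eq_zero fun m => ?_
    by_cases hm : β (j - 2 * m) = 0
    · rw [hm, zero_mul]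
    · rw [ih fun k hk => h k ?_, mul_zero]
      calc |j - 2 ^ (n + 1) * k| = |(j - 2 * m) + 2 * (m - 2 ^ n * k)| := by
            congr 1; rw [pow_succ]; ring
        _ ≤ |j - 2 * m| + 2 * |m - 2 ^ n * k| := by
            simpa only [abs_mul, abs_two] using abs_add_le (j - 2 * m) (2 * (m - 2 ^ n * k))
        _ ≤ shiftExp β + 2 * ((2 ^ n - 1) * shiftExp β) := by
            gcongr; exact abs_le_shiftExp hm
        _ = (2 ^ (n + 1) - 1) * shiftExp β := by rw [pow_succ]; ring

variable (β) in
/-- The values after `n` refinement steps from the unit impulse at `0`, that is, the mask of the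
`n`-th iterate of the subdivision operator. -/
noncomputable def impulse (n : ℕ) : ℤ → ℝ := (subdivide β)^[n] (Pi.single 0 1)

lemma impulse_succ (n : ℕ) : impulse β (n + 1) = subdivide β (impulse β n) :=
  Function.iterate_succ_apply' _ _ _

lemma impulse_eq_zero {n : ℕ} {j : ℤ} (hj : 2 ^ n * shiftExp β < |j|) : impulse β n j = 0 := by
  refine iterate_subdivide_eq_zero fun k hk => Pi.single_eq_of_ne ?_ 1
  rintro rfl
  rw [mul_zero, sub_zero, sub_one_mul] at hk
  omega

lemma impulse_eq_zero_of_lt_abs_div {n : ℕ} {j : ℤ} (hj : shiftExp β < |(j : ℝ) / 2 ^ n|) :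
    impulse β n j = 0 := by
  rw [abs_div, abs_of_pos (by positivity : (0 : ℝ) < 2 ^ n), lt_div_iff₀ (by positivity),
    mul_comm] at hj
  exact impulse_eq_zero (by exact_mod_cast hj)

lemma iterate_subdivide_single (n : ℕ) (j k : ℤ) :
    (subdivide β)^[n] (Pi.single k 1) j = impulse β n (j - 2 ^ n * k) := by
  have hshift : (Pi.single k 1 : ℤ → ℝ) = fun m => (Pi.single 0 1 : ℤ → ℝ) (m + -k) := by
    ext m
    simp only [Pi.single_apply, ← sub_eq_add_neg, sub_eq_zero]
  rw [hshift, iterate_subdivide_shift, mul_neg, ← sub_eq_add_neg, impulse]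

lemma iterate_subdivide_eq_sum {n : ℕ} {j : ℤ} {F : Finset ℤ}
    (hF : ∀ k, |j - 2 ^ n * k| ≤ (2 ^ n - 1) * shiftExp β → k ∈ F) (c : ℤ → ℝ) :
    (subdivide β)^[n] c j = ∑ k ∈ F, c k * impulse β n (j - 2 ^ n * k) := by
  have hlocal : (subdivide β)^[n] (c - ∑ k ∈ F, c k • Pi.single k (1 : ℝ)) j = 0 :=
    iterate_subdivide_eq_zero fun k hk => by
      simp [Finset.sum_apply, Pi.single_apply, hF k hk]
  rw [← subdivideₗ_pow_apply, map_sub, map_sum] at hlocal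
  simpa only [map_smul, subdivideₗ_pow_apply, Pi.sub_apply, Finset.sum_apply, Pi.smul_apply,
    smul_eq_mul, iterate_subdivide_single, sub_eq_zero] using hlocal

lemma exists_abs_impulse_le (β : ℤ →₀ ℝ) (n : ℕ) : ∃ B : ℝ≥0, ∀ j, |impulse β n j| ≤ B := by
  have hfin : (Function.support (impulse β n)).Finite :=
    (Set.finite_Icc (-(2 ^ n * shiftExp β : ℤ)) (2 ^ n * shiftExp β)).subset fun j hj =>
      abs_le.1 (not_lt.1 fun h => hj (impulse_eq_zero h))
  obtain ⟨B, hB⟩ := (hfin.image fun j => |impulse β n j|).bddAbove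
  refine ⟨B.toNNReal, fun j => ?_⟩
  by_cases hj : impulse β n j = 0
  · rw [hj, abs_zero]; exact NNReal.coe_nonneg _
  · exact (hB ⟨j, hj, rfl⟩).trans (Real.le_coe_toNNReal B)

lemma tendsto_subdivide {ι : Type*} {l : Filter ι} {γ : ι → ℤ →₀ ℝ} {N : ℕ}
    (hN : ∀ᶠ t in l, shiftExp (γ t) ≤ N) (hγ : Tendsto (fun t => ⇑(γ t)) l (𝓝 β))
    {c : ι → ℤ → ℝ} {d : ℤ → ℝ} (hc : Tendsto c l (𝓝 d)) :
    Tendsto (fun t => subdivide (γ t) (c t)) l (𝓝 (subdivide β d)) := by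
  rw [tendsto_pi_nhds] at hγ hc ⊢
  intro j
  rw [subdivide_eq_sum (fun _ => mem_Icc_of_apply_ne_zero (le_max_right N (shiftExp β)))]
  refine (tendsto_finsetSum _ fun k _ => (hγ (j - 2 * k)).mul (hc k)).congr' ?_
  filter_upwards [hN] with t ht
  exact (subdivide_eq_sum (fun _ => mem_Icc_of_apply_ne_zero (ht.trans (le_max_left _ _))) _).symm

lemma tendsto_iterate_subdivide {ι : Type*} {l : Filter ι} {γ : ι → ℤ →₀ ℝ} {N : ℕ}
    (hN : ∀ᶠ t in l, shiftExp (γ t) ≤ N) (hγ : Tendsto (fun t => ⇑(γ t)) l (𝓝 β))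
    (c : ℤ → ℝ) (n : ℕ) :
    Tendsto (fun t => (subdivide (γ t))^[n] c) l (𝓝 ((subdivide β)^[n] c)) := by
  induction n with
  | zero => exact tendsto_const_nhds
  | succ n ih =>
    simp only [Function.iterate_succ_apply']
    exact tendsto_subdivide hN hγ ih

section LimitFunctions

variable {c : ℤ → ℝ} {f φ : ℝ → ℝ}

lemma IsLimitFunction.tendsto {ι : Type*} {l : Filter ι} (hf : IsLimitFunction β c f) {ν : ι → ℕ}
    {j : ι → ℤ} {x : ℝ} (hν : Tendsto ν l atTop)
    (hj : Tendsto (fun t => (j t : ℝ) / 2 ^ ν t) l (𝓝 x)) :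
    Tendsto (fun t => (subdivide β)^[ν t] c (j t)) l (𝓝 (f x)) := by
  have herr : Tendsto (fun t => (subdivide β)^[ν t] c (j t) - f (j t / 2 ^ ν t)) l (𝓝 0) := by
    rw [Metric.tendsto_nhds]
    intro ε hε
    obtain ⟨n₀, hn₀⟩ := hf.2 (x - 1) (x + 1) ε hε
    filter_upwards [hν.eventually_ge_atTop n₀,
      hj.eventually (Icc_mem_nhds (sub_one_lt x) (lt_add_one x))] with t ht htx
    rw [Real.dist_eq, sub_zero]
    exact hn₀ _ ht _ htx
  simpa using herr.add ((hf.1.tendsto x).comp hj)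

lemma IsLimitFunction.subdivide_one (hf : IsLimitFunction β c f) (h0 : f ≠ 0) :
    subdivide β 1 = 1 := by
  obtain ⟨x, hx⟩ := Function.ne_iff.1 h0
  -- Near `x` the refined data approach the constant `f x`, and so do their refinements, so this
  -- constant is a fixed point.
  set m : ℕ → ℤ := fun n => ⌊2 ^ n * x⌋
  have hm : Tendsto (fun n => (m n : ℝ) / 2 ^ n) atTop (𝓝 x) := tendsto_floor_two_pow_mul_div x
  have hlocal : Tendsto (fun n k => (subdivide β)^[n] c (k + m n)) atTop (𝓝 (f x • 1)) := by
    refine tendsto_pi_nhds.2 fun k => ?_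
    rw [Pi.smul_apply, Pi.one_apply, smul_eq_mul, mul_one]
    refine hf.tendsto tendsto_id ?_
    simpa [add_div] using (tendsto_const_div_two_pow k).add hm
  have hrefined : ∀ j, Tendsto (fun n => (subdivide β)^[n + 1] c (j + 2 * m n)) atTop
      (𝓝 (f x)) := fun j => by
    refine hf.tendsto (tendsto_add_atTop_nat 1) ?_
    have hsum := ((tendsto_const_div_two_pow j).comp (tendsto_add_atTop_nat 1)).add hm
    rw [zero_add] at hsum
    refine hsum.congr fun n => ?_
    push_cast
    rw [Function.comp_apply, add_div, pow_succ', mul_div_mul_left _ _ two_ne_zero]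
  ext j
  have hlim := tendsto_pi_nhds.1
    (tendsto_subdivide (γ := fun _ => β) (.of_forall fun _ => le_rfl) tendsto_const_nhds hlocal) j
  simp only [subdivide_shift] at hlim
  have hfix := tendsto_nhds_unique hlim
    (by simpa only [Function.iterate_succ_apply'] using hrefined j)
  have hsmul : subdivide β (f x • 1) = f x • subdivide β 1 := (subdivideₗ β).map_smul (f x) 1
  rw [hsmul, Pi.smul_apply, smul_eq_mul] at hfix
  exact mul_left_cancel₀ hx (hfix.trans (mul_one _).symm)

lemma IsLimitFunction.eq_zero_of_lt_abs (hφ : IsLimitFunction β (Pi.single 0 1) φ) {x : ℝ}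
    (hx : shiftExp β < |x|) : φ x = 0 := by
  have hm := tendsto_floor_two_pow_mul_div x
  refine tendsto_nhds_unique (hφ.tendsto tendsto_id hm) (tendsto_const_nhds.congr' ?_)
  filter_upwards [hm.abs.eventually (lt_mem_nhds hx)] with n hn
  exact (impulse_eq_zero_of_lt_abs_div hn).symm

lemma IsLimitFunction.eventually_abs_impulse_sub_lt (hφ : IsLimitFunction β (Pi.single 0 1) φ)
    {ε : ℝ} (hε : 0 < ε) : ∀ᶠ n in atTop, ∀ j : ℤ, |impulse β n j - φ (j / 2 ^ n)| < ε := by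
  obtain ⟨n₀, hn₀⟩ := hφ.2 (-shiftExp β) (shiftExp β) ε hε
  filter_upwards [eventually_ge_atTop n₀] with n hn j
  rcases le_or_gt |(j : ℝ) / 2 ^ n| (shiftExp β) with hj | hj
  · exact hn₀ n hn j (abs_le.1 hj)
  · rwa [hφ.eq_zero_of_lt_abs hj, impulse_eq_zero_of_lt_abs_div hj, sub_zero, abs_zero]

lemma IsLimitFunction.uniformContinuous (hφ : IsLimitFunction β (Pi.single 0 1) φ) :
    UniformContinuous φ :=
  HasCompactSupport.uniformContinuous_of_continuous
    (.intro (isCompact_Icc (a := (-shiftExp β : ℝ)) (b := shiftExp β)) fun _ hx =>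
      hφ.eq_zero_of_lt_abs (not_le.1 fun h => hx (abs_le.1 h))) hφ.1

lemma IsLimitFunction.eventually_dist_impulse_lt (hφ : IsLimitFunction β (Pi.single 0 1) φ)
    {ε : ℝ} (hε : 0 < ε) :
    ∀ᶠ n in atTop, ∀ j, dist (impulse β n j) (impulse β n (j + 1)) < ε := by
  obtain ⟨η, hη, huc⟩ := Metric.uniformContinuous_iff.1 hφ.uniformContinuous (ε / 3) (by positivity)
  filter_upwards [hφ.eventually_abs_impulse_sub_lt (by positivity : 0 < ε / 3),
    (tendsto_const_div_two_pow 1).eventually (gt_mem_nhds hη)] with n herr hmesh j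
  have hnear : dist ((j : ℝ) / 2 ^ n) (((j + 1 : ℤ) : ℝ) / 2 ^ n) < η := by
    rwa [dist_comm, Real.dist_eq, ← sub_div, Int.cast_add, Int.cast_one, add_sub_cancel_left,
      abs_of_pos (by positivity)]
  calc dist (impulse β n j) (impulse β n (j + 1))
      ≤ dist (impulse β n j) (φ (j / 2 ^ n)) +
          dist (φ (j / 2 ^ n)) (φ ((j + 1 : ℤ) / 2 ^ n)) +
          dist (φ ((j + 1 : ℤ) / 2 ^ n)) (impulse β n (j + 1)) := dist_triangle4 _ _ _ _
    _ < ε / 3 + ε / 3 + ε / 3 := by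
        gcongr
        · exact herr j
        · exact huc hnear
        · rw [dist_comm]; exact herr (j + 1)
    _ = ε := by ring

lemma mem_Icc_of_abs_sub_le {a b x : ℝ} {R : ℕ} {k : ℤ} (hx : x ∈ Set.Icc a b)
    (hk : |x - k| ≤ R) : k ∈ Finset.Icc (⌊a⌋ - R) (⌈b⌉ + R) := by
  obtain ⟨hkx, hxk⟩ := abs_le.1 hk
  rw [Finset.mem_Icc]
  constructor
  · exact_mod_cast (by linarith [Int.floor_le a, hx.1] : (⌊a⌋ - R : ℝ) ≤ k)
  · exact_mod_cast (by linarith [Int.le_ceil b, hx.2] : (k : ℝ) ≤ ⌈b⌉ + R)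

lemma IsLimitFunction.abs_sub_le_of_ne_zero (hφ : IsLimitFunction β (Pi.single 0 1) φ) {x : ℝ}
    {k : ℤ} (h : c k * φ (x - k) ≠ 0) : |x - k| ≤ shiftExp β :=
  not_lt.1 fun hlt => right_ne_zero_of_mul h (hφ.eq_zero_of_lt_abs hlt)

lemma IsLimitFunction.continuous_superposition (hφ : IsLimitFunction β (Pi.single 0 1) φ)
    (c : ℤ → ℝ) : Continuous fun x : ℝ => ∑ᶠ k : ℤ, c k * φ (x - k) := by
  have hφc : Continuous φ := hφ.1
  refine continuous_finsum (fun k => by fun_prop) fun x => ⟨Set.Icc (x - 1) (x + 1),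
    Icc_mem_nhds (sub_one_lt x) (lt_add_one x),
    (Finset.finite_toSet (.Icc (⌊x - 1⌋ - shiftExp β) (⌈x + 1⌉ + shiftExp β))).subset ?_⟩
  rintro k ⟨y, hky, hy⟩
  exact mem_Icc_of_abs_sub_le hy (hφ.abs_sub_le_of_ne_zero hky)

theorem IsLimitFunction.superposition (hφ : IsLimitFunction β (Pi.single 0 1) φ) (c : ℤ → ℝ) :
    IsLimitFunction β c fun x => ∑ᶠ k : ℤ, c k * φ (x - k) := by
  refine ⟨hφ.continuous_superposition c, fun a b ε hε => ?_⟩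
  set F := Finset.Icc (⌊a⌋ - shiftExp β) (⌈b⌉ + shiftExp β)
  set T := ∑ k ∈ F, |c k|
  have hT : 0 < T + 1 :=
    add_pos_of_nonneg_of_pos (Finset.sum_nonneg fun _ _ => abs_nonneg _) one_pos
  obtain ⟨n₀, hn₀⟩ := eventually_atTop.1
    (hφ.eventually_abs_impulse_sub_lt (div_pos hε hT))
  refine ⟨n₀, fun n hn j hj => ?_⟩
  have hp : (0 : ℝ) < 2 ^ n := by positivity
  have hgrid : ∀ k : ℤ, (j : ℝ) / 2 ^ n - k = (j - 2 ^ n * k : ℤ) / 2 ^ n := fun k => by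
    push_cast; rw [sub_div, mul_div_cancel_left₀ _ hp.ne']
  have hF : ∀ k : ℤ, |j - 2 ^ n * k| ≤ (2 ^ n - 1) * shiftExp β → k ∈ F := fun k hk => by
    refine mem_Icc_of_abs_sub_le hj ?_
    rw [hgrid, abs_div, abs_of_pos hp, div_le_iff₀ hp]
    have hk' : |j - 2 ^ n * k| ≤ shiftExp β * 2 ^ n := by linarith
    exact_mod_cast hk'
  have hFφ : (Function.support fun k : ℤ => c k * φ (j / 2 ^ n - k)) ⊆ F := fun k hk =>
    mem_Icc_of_abs_sub_le hj (hφ.abs_sub_le_of_ne_zero hk)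
  beta_reduce
  rw [iterate_subdivide_eq_sum hF, finsum_eq_sum_of_support_subset _ hFφ]
  calc |∑ k ∈ F, c k * impulse β n (j - 2 ^ n * k) - ∑ k ∈ F, c k * φ (j / 2 ^ n - k)|
      ≤ ∑ k ∈ F, |c k| * (ε / (T + 1)) := by
        rw [← Finset.sum_sub_distrib]
        refine (Finset.abs_sum_le_sum_abs _ _).trans (Finset.sum_le_sum fun k _ => ?_)
        rw [← mul_sub, abs_mul, hgrid]
        exact mul_le_mul_of_nonneg_left (hn₀ n hn _).le (abs_nonneg _)
    _ = T / (T + 1) * ε := by rw [← Finset.sum_mul]; ring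
    _ < ε := mul_lt_of_lt_one_left hε ((div_lt_one hT).2 (lt_add_one T))

end LimitFunctions

section Contractivity

variable {c : ℤ → ℝ} {n : ℕ} {B D K : ℝ≥0}

lemma abs_sub_ediv_two_pow_le {N n : ℕ} {j k : ℤ} (h : |j - 2 ^ n * k| ≤ (2 ^ n - 1) * N + 1) :
    |k - j / 2 ^ n| ≤ N + 1 := by
  have hp : (0 : ℤ) < 2 ^ n := by positivity
  have hj := Int.mul_ediv_add_emod j (2 ^ n)
  have hr₀ := Int.emod_nonneg j hp.ne'
  have hr₁ := Int.emod_lt_of_pos j hp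
  obtain ⟨hlow, hupp⟩ := abs_le.1 h
  refine abs_le.2 ⟨?_, ?_⟩ <;> refine le_of_mul_le_mul_left ?_ hp <;> nlinarith

lemma abs_sum_Icc_sub_mul_le {v : ℤ → ℝ} (hc : LipschitzWith K c) (hv : ∀ k, |v k| ≤ B) (k₀ : ℤ)
    (R : ℕ) :
    |∑ k ∈ Finset.Icc (k₀ - R) (k₀ + R), (c k - c k₀) * v k| ≤ (2 * R + 1) * R * K * B := by
  have hcard : (Finset.Icc (k₀ - R) (k₀ + R)).card = 2 * R + 1 := by
    rw [Int.card_Icc]; omega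
  calc |∑ k ∈ Finset.Icc (k₀ - R) (k₀ + R), (c k - c k₀) * v k|
      ≤ ∑ _k ∈ Finset.Icc (k₀ - R) (k₀ + R), K * R * (B : ℝ) := by
        refine (Finset.abs_sum_le_sum_abs _ _).trans (Finset.sum_le_sum fun k hk => ?_)
        have hdist : dist k k₀ ≤ R := by
          rw [Finset.mem_Icc] at hk
          rw [Int.dist_eq']
          exact_mod_cast abs_le.2 ⟨by omega, by omega⟩
        rw [abs_mul]
        gcongr
        · exact (hc.dist_le_mul k k₀).trans (by gcongr)
        · exact hv k
    _ = (2 * R + 1) * R * K * B := by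
        rw [Finset.sum_const, hcard, nsmul_eq_mul]; push_cast; ring

/-- The factor lost when refined values of a scheme with mask in `[-N, N]` are estimated through
the differences of the data: such a value involves at most `2 * (N + 1) + 1` coefficients, at
distance at most `N + 1` from the central one. -/
def localityConst (N : ℕ) : ℝ≥0 := (2 * (N + 1) + 1) * (N + 1)

lemma localityConst_mono : Monotone localityConst := fun M N h => by
  unfold localityConst; gcongr

lemma iterate_subdivide_sub_eq_sum (h1 : subdivide β 1 = 1) {j : ℤ} {F : Finset ℤ}
    (hF : ∀ k, |j - 2 ^ n * k| ≤ (2 ^ n - 1) * shiftExp β → k ∈ F) (c : ℤ → ℝ) (t : ℝ) :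
    (subdivide β)^[n] c j - t = ∑ k ∈ F, (c k - t) * impulse β n (j - 2 ^ n * k) := by
  have hone := iterate_subdivide_eq_sum hF 1
  rw [Function.iterate_fixed h1] at hone
  simp only [Pi.one_apply, one_mul] at hone
  rw [iterate_subdivide_eq_sum hF]
  simp only [sub_mul, Finset.sum_sub_distrib, ← Finset.mul_sum, ← hone, mul_one]

lemma mem_Icc_ediv_two_pow {j k : ℤ} (h : |j - 2 ^ n * k| ≤ (2 ^ n - 1) * shiftExp β + 1) :
    k ∈ Finset.Icc (j / 2 ^ n - (shiftExp β + 1 : ℕ)) (j / 2 ^ n + (shiftExp β + 1 : ℕ)) := by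
  have := abs_le.1 (abs_sub_ediv_two_pow_le h)
  rw [Finset.mem_Icc]
  omega

lemma dist_iterate_subdivide_le (h1 : subdivide β 1 = 1) (hB : ∀ j, |impulse β n j| ≤ B)
    (hc : LipschitzWith K c) (j : ℤ) :
    dist (c (j / 2 ^ n)) ((subdivide β)^[n] c j) ≤ localityConst (shiftExp β) * K * B := by
  rw [dist_comm, Real.dist_eq,
    iterate_subdivide_sub_eq_sum h1 fun k hk =>
      mem_Icc_ediv_two_pow (hk.trans (le_add_of_nonneg_right zero_le_one))]
  simpa [localityConst] using abs_sum_Icc_sub_mul_le hc (fun k => hB (j - 2 ^ n * k)) (j / 2 ^ n)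
    (shiftExp β + 1)

lemma lipschitzWith_iterate_subdivide (h1 : subdivide β 1 = 1)
    (hD : LipschitzWith D (impulse β n)) (hc : LipschitzWith K c) :
    LipschitzWith (localityConst (shiftExp β) * K * D) ((subdivide β)^[n] c) := by
  refine lipschitzWith_of_dist_succ_le fun j => ?_
  have hnear : ∀ k, |j + 1 - 2 ^ n * k| ≤ (2 ^ n - 1) * shiftExp β →
      |j - 2 ^ n * k| ≤ (2 ^ n - 1) * shiftExp β + 1 := fun k hk => by
    rw [abs_le] at hk ⊢; constructor <;> linarith
  have hdiff : ∀ k, |impulse β n (j - 2 ^ n * k) - impulse β n (j + 1 - 2 ^ n * k)| ≤ D :=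
    fun k => by
      have h := hD.dist_le_mul (j - 2 ^ n * k) (j + 1 - 2 ^ n * k)
      rwa [Real.dist_eq, Int.dist_eq', show j - 2 ^ n * k - (j + 1 - 2 ^ n * k) = -1 by ring,
        abs_neg, abs_one, Int.cast_one, mul_one] at h
  rw [Real.dist_eq, ← sub_sub_sub_cancel_right _ _ (c (j / 2 ^ n)),
    iterate_subdivide_sub_eq_sum h1 fun k hk =>
      mem_Icc_ediv_two_pow (hk.trans (le_add_of_nonneg_right zero_le_one)),
    iterate_subdivide_sub_eq_sum h1 fun k hk => mem_Icc_ediv_two_pow (hnear k hk),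
    ← Finset.sum_sub_distrib]
  simp only [← mul_sub]
  simpa [localityConst] using abs_sum_Icc_sub_mul_le hc hdiff (j / 2 ^ n) (shiftExp β + 1)

lemma exists_lipschitzWith_impulse (β : ℤ →₀ ℝ) (n : ℕ) :
    ∃ D : ℝ≥0, LipschitzWith D (impulse β n) := by
  obtain ⟨B, hB⟩ := exists_abs_impulse_le β n
  refine ⟨B + B, lipschitzWith_of_dist_succ_le fun j => ?_⟩
  exact (abs_sub _ _).trans (add_le_add (hB j) (hB (j + 1)))

lemma exists_geometric_lipschitzWith_impulse (h1 : subdivide β 1 = 1) {L : ℕ} (hL : L ≠ 0)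
    (hD : LipschitzWith D (impulse β L)) (hcontr : localityConst (shiftExp β) * D ≤ 1 / 2) :
    ∃ K ρ : ℝ≥0, ρ < 1 ∧ ∀ n, LipschitzWith (K * ρ ^ n) (impulse β n) := by
  choose E hE using exists_lipschitzWith_impulse β
  set a : ℕ → ℝ≥0 := fun n => E (n % L) / 2 ^ (n / L)
  have hlip : ∀ q i, LipschitzWith (E i / 2 ^ q) (impulse β (i + L * q)) := fun q i => by
    induction q with
    | zero => simpa using hE i
    | succ q ih =>
      rw [show i + L * (q + 1) = L + (i + L * q) by ring, impulse, Function.iterate_add_apply]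
      refine (lipschitzWith_iterate_subdivide h1 hD ih).weaken ?_
      calc localityConst (shiftExp β) * (E i / 2 ^ q) * D
          = localityConst (shiftExp β) * D * (E i / 2 ^ q) := by ring
        _ ≤ 1 / 2 * (E i / 2 ^ q) := by gcongr
        _ = E i / 2 ^ (q + 1) := by rw [pow_succ]; field_simp
  obtain ⟨K, ρ, hρ, ha⟩ := exists_geometric_bound_of_add_eq_half (a := a) hL fun n => by
    simp only [a, Nat.add_mod_right, Nat.add_div_right _ (Nat.pos_of_ne_zero hL), pow_succ,
      div_mul_eq_div_div]
  refine ⟨K, ρ, hρ, fun n => LipschitzWith.weaken ?_ (ha n)⟩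
  simpa only [Nat.mod_add_div] using hlip (n / L) (n % L)

lemma exists_isLimitFunction_impulse (h1 : subdivide β 1 = 1) {ρ : ℝ≥0} (hρ : ρ < 1)
    (hK : ∀ n, LipschitzWith (K * ρ ^ n) (impulse β n)) :
    ∃ φ, IsLimitFunction β (Pi.single 0 1) φ := by
  obtain ⟨B, hB⟩ := exists_abs_impulse_le β 1
  set A : ℝ := localityConst (shiftExp β) * K * B
  have hstep : ∀ n j, dist (impulse β n (j / 2)) (impulse β (n + 1) j) ≤ A * ρ ^ n := fun n j => by
    have h := dist_iterate_subdivide_le h1 hB (hK n) j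
    rw [pow_one, Function.iterate_one, ← impulse_succ] at h
    refine h.trans_eq ?_
    push_cast
    ring
  obtain ⟨φ, hφc, hφ⟩ := exists_continuous_dyadic_limit hρ hK hstep
  have herr : Tendsto (fun n : ℕ => A * (ρ : ℝ) ^ n / (1 - ρ)) atTop (𝓝 0) := by
    simpa using ((tendsto_pow_atTop_nhds_zero_of_lt_one ρ.coe_nonneg hρ).const_mul A).div_const
      (1 - (ρ : ℝ))
  refine ⟨φ, hφc, fun _ _ ε hε => ?_⟩
  obtain ⟨n₀, hn₀⟩ := eventually_atTop.1 (herr.eventually (gt_mem_nhds hε))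
  exact ⟨n₀, fun n hn j _ => (hφ n j).trans_lt (hn₀ n hn)⟩

theorem isConvergent_of_lipschitzWith_impulse (h1 : subdivide β 1 = 1) {L : ℕ} (hL : L ≠ 0)
    (hD : LipschitzWith D (impulse β L)) (hcontr : localityConst (shiftExp β) * D ≤ 1 / 2) :
    IsConvergent β := by
  obtain ⟨K, ρ, hρ, hK⟩ := exists_geometric_lipschitzWith_impulse h1 hL hD hcontr
  obtain ⟨φ, hφ⟩ := exists_isLimitFunction_impulse h1 hρ hK
  refine ⟨fun c => ⟨_, hφ.superposition c⟩, 1, 1, ⟨continuous_one, fun _ _ ε hε => ?_⟩, one_ne_zero⟩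
  exact ⟨0, fun n _ j _ => by simpa [Function.iterate_fixed h1] using hε⟩

theorem IsConvergent.eventually_of_tendsto {ι : Type*} {l : Filter ι} {γ : ι → ℤ →₀ ℝ} {N : ℕ}
    (hβ : IsConvergent β) (hN : ∀ᶠ t in l, shiftExp (γ t) ≤ N)
    (hγ : Tendsto (fun t => ⇑(γ t)) l (𝓝 β)) (h1 : ∀ᶠ t in l, subdivide (γ t) 1 = 1) :
    ∀ᶠ t in l, IsConvergent (γ t) := by
  obtain ⟨φ, hφ⟩ := hβ.1 (Pi.single 0 1)
  have hW : 0 < localityConst N := by unfold localityConst; positivity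
  set D : ℝ≥0 := 1 / 2 / localityConst N
  have hD : (0 : ℝ) < D := by positivity
  obtain ⟨L, hsmall, hL⟩ :=
    ((hφ.eventually_dist_impulse_lt hD).and (eventually_ne_atTop 0)).exists
  have hsupp : ∀ᶠ t in l, ∀ j, 2 ^ L * (N : ℤ) < |j| → impulse (γ t) L j = 0 :=
    hN.mono fun t ht j hj => impulse_eq_zero (lt_of_le_of_lt (by gcongr) hj)
  have hlip : ∀ᶠ t in l, LipschitzWith D (impulse (γ t) L) :=
    eventually_lipschitzWith_of_tendsto (tendsto_iterate_subdivide hN hγ _ L) hsupp hsmall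
  filter_upwards [hN, h1, hlip] with t htN ht1 htD
  refine isConvergent_of_lipschitzWith_impulse ht1 hL htD ?_
  calc localityConst (shiftExp (γ t)) * D ≤ localityConst N * D := by
        gcongr; exact localityConst_mono htN
    _ = 1 / 2 := mul_div_cancel₀ _ hW.ne'

end Contractivity

section ApproxPoly

variable {p : ℂ[X]}

lemma C_leadingCoeff_mul_displaced_zero (p : ℂ[X]) : C p.leadingCoeff * displaced p 0 = p := by
  have hfactors : displaced p 0 = (p.roots.map fun r => X - C r).prod := by
    simp only [displaced, Complex.ofReal_zero, add_zero, one_mul, ite_self]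
  rw [hfactors]
  exact (IsAlgClosed.splits p).eq_prod_roots.symm

lemma leadingCoeff_mul_eval_one_displaced_zero (hp : p.eval 1 = 1) :
    p.leadingCoeff * (displaced p 0).eval 1 = 1 := by
  simpa only [eval_mul, eval_C, hp] using congrArg (eval 1) (C_leadingCoeff_mul_displaced_zero p)

lemma approxPoly_zero (hp : p.eval 1 = 1) : approxPoly p 0 = p := by
  rw [approxPoly, ← eq_inv_of_mul_eq_one_left (leadingCoeff_mul_eval_one_displaced_zero hp),
    C_leadingCoeff_mul_displaced_zero]

lemma continuous_coeff_displaced (p : ℂ[X]) (n : ℕ) :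
    Continuous fun ξ : ℝ => (displaced p ξ).coeff n := by
  unfold displaced
  induction p.roots using Multiset.induction_on generalizing n with
  | empty => simpa only [Multiset.map_zero, Multiset.prod_zero] using continuous_const
  | cons r s ih =>
    simp only [Multiset.map_cons, Multiset.prod_cons, coeff_mul]
    refine continuous_finsetSum _ fun x _ => Continuous.mul ?_ (ih _)
    simp only [coeff_sub, coeff_C]
    refine continuous_const.sub ?_
    split_ifs <;> fun_prop

lemma natDegree_displaced (p : ℂ[X]) (ξ : ℝ) : (displaced p ξ).natDegree = p.roots.card := by
  simpa only [displaced, Multiset.map_map, Function.comp_def, Multiset.card_map] using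
    natDegree_multiset_prod_X_sub_C_eq_card
      (p.roots.map fun r : ℂ => if ‖r‖ = 1 then (1 + (ξ : ℂ)) * r else r)

lemma continuous_eval_displaced (p : ℂ[X]) (z : ℂ) :
    Continuous fun ξ : ℝ => (displaced p ξ).eval z := by
  simp only [eval_eq_sum_range, natDegree_displaced]
  exact continuous_finsetSum _ fun n _ => (continuous_coeff_displaced p n).mul continuous_const

lemma eventually_eval_one_approxPoly (hp : p.eval 1 = 1) :
    ∀ᶠ ξ in 𝓝 (0 : ℝ), (approxPoly p ξ).eval 1 = 1 := by
  have hne := right_ne_zero_of_mul_eq_one (leadingCoeff_mul_eval_one_displaced_zero hp)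
  filter_upwards [(continuous_eval_displaced p 1).continuousAt.eventually_ne hne] with ξ hξ
  rw [approxPoly, eval_mul, eval_C, inv_mul_cancel₀ hξ]

lemma tendsto_coeff_approxPoly (hp : p.eval 1 = 1) (n : ℕ) :
    Tendsto (fun ξ : ℝ => (approxPoly p ξ).coeff n) (𝓝 0) (𝓝 (p.coeff n)) := by
  have hne := right_ne_zero_of_mul_eq_one (leadingCoeff_mul_eval_one_displaced_zero hp)
  conv_rhs => rw [← approxPoly_zero hp]
  simp only [approxPoly, coeff_C_mul]
  exact (((continuous_eval_displaced p 1).tendsto 0).inv₀ hne).mul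
    ((continuous_coeff_displaced p n).tendsto 0)

lemma natDegree_approxPoly_le (p : ℂ[X]) (ξ : ℝ) : (approxPoly p ξ).natDegree ≤ p.natDegree :=
  calc (approxPoly p ξ).natDegree ≤ (displaced p ξ).natDegree := natDegree_C_mul_le _ _
    _ = p.roots.card := natDegree_displaced p ξ
    _ ≤ p.natDegree := card_roots' p

end ApproxPoly

section Symbol

variable {a : ℤ →₀ ℝ}

lemma coeff_symbolPoly (a : ℤ →₀ ℝ) (n : ℕ) : (symbolPoly a).coeff n = a (n - shiftExp a) := by
  rw [symbolPoly, finsetSum_coeff, Finset.sum_eq_single ((n : ℤ) - shiftExp a)]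
  · rw [coeff_monomial, if_pos (by omega)]
  · intro k hk hne
    have := abs_le.1 (abs_le_shiftExp (Finsupp.mem_support_iff.1 hk))
    rw [coeff_monomial, if_neg (by omega)]
  · intro h
    rw [Finsupp.notMem_support_iff.1 h, monomial_zero_right, coeff_zero]

lemma natDegree_symbolPoly_le (a : ℤ →₀ ℝ) : (symbolPoly a).natDegree ≤ 2 * shiftExp a := by
  refine natDegree_le_iff_coeff_eq_zero.2 fun n hn => ?_
  rw [coeff_symbolPoly]
  by_contra h
  have := abs_le.1 (abs_le_shiftExp h)
  omega

lemma eval_one_symbolPoly (a : ℤ →₀ ℝ) : (symbolPoly a).eval 1 = ∑ᶠ k, a k := by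
  rw [symbolPoly, eval_finsetSum, finsum_eq_sum_of_support_subset (s := a.support)]
  · simp only [eval_monomial, one_pow, mul_one]
  · rw [Finsupp.fun_support_eq]

lemma eval_one_map_symbolPoly (ha : ∑ᶠ k, a k = 1) :
    ((symbolPoly a).map (algebraMap ℝ ℂ)).eval 1 = 1 := by
  rw [eval_one_map, eval_one_symbolPoly, ha, map_one]

lemma abs_le_shiftExp_of_approxCoeff_ne_zero {ξ : ℝ} {k : ℤ} (h : approxCoeff a ξ k ≠ 0) :
    |k| ≤ shiftExp a := by
  obtain ⟨hk, hcoeff⟩ := ite_ne_right_iff.1 h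
  have hdeg := (le_natDegree_of_ne_zero hcoeff).trans (natDegree_approxPoly_le _ ξ)
  rw [natDegree_map] at hdeg
  have := natDegree_symbolPoly_le a
  rw [abs_le]
  omega

lemma tendsto_approxCoeff (ha : ∑ᶠ k, a k = 1) (k : ℤ) :
    Tendsto (fun ξ : ℝ => approxCoeff a ξ k) (𝓝 0) (𝓝 (a k : ℂ)) := by
  by_cases hk : 0 ≤ k + shiftExp a
  · have h := tendsto_coeff_approxPoly (eval_one_map_symbolPoly ha) (k + shiftExp a).toNat
    rw [coeff_map, coeff_symbolPoly, Int.toNat_of_nonneg hk, add_sub_cancel_right] at h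
    simpa only [approxCoeff, if_pos hk, Complex.coe_algebraMap] using h
  · have hak : a k = 0 := by
      by_contra h
      have := abs_le.1 (abs_le_shiftExp h)
      omega
    simp only [approxCoeff, if_neg hk, hak, Complex.ofReal_zero]
    exact tendsto_const_nhds

lemma finsum_approxCoeff (a : ℤ →₀ ℝ) (ξ : ℝ) : ∑ᶠ k, approxCoeff a ξ k =
    (approxPoly ((symbolPoly a).map (algebraMap ℝ ℂ)) ξ).eval 1 := by
  set q := approxPoly ((symbolPoly a).map (algebraMap ℝ ℂ)) ξ
  have hcoeff : ∀ n : ℕ, approxCoeff a ξ (n - shiftExp a) = q.coeff n := fun n => by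
    rw [approxCoeff, sub_add_cancel, if_pos (Int.natCast_nonneg n), Int.toNat_natCast]
  have hsupp : (Function.support (approxCoeff a ξ)) ⊆
      (Finset.range (q.natDegree + 1)).image fun n : ℕ => (n : ℤ) - shiftExp a := fun k hk => by
    obtain ⟨hk₀, hk₁⟩ := ite_ne_right_iff.1 hk
    rw [Finset.mem_coe, Finset.mem_image]
    exact ⟨_, Finset.mem_range_succ_iff.2 (le_natDegree_of_ne_zero hk₁), by omega⟩
  rw [finsum_eq_sum_of_support_subset _ hsupp,
    Finset.sum_image fun m _ n _ h => by simpa using h, eval_eq_sum_range]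
  simp only [hcoeff, one_pow, mul_one]

lemma eventually_finsum_re_approxCoeff (ha : ∑ᶠ k, a k = 1) :
    ∀ᶠ ξ in 𝓝 (0 : ℝ), ∑ᶠ k, (approxCoeff a ξ k).re = 1 := by
  filter_upwards [eventually_eval_one_approxPoly (eval_one_map_symbolPoly ha)] with ξ hξ
  have hre : ∀ k, ((approxCoeff a ξ k).re : ℂ) = approxCoeff a ξ k := fun k =>
    Complex.ext rfl (approxCoeff_im a ξ k).symm
  have hsum := (Complex.ofRealHom : ℝ →+ ℂ).map_finsum_of_injective Complex.ofReal_injective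
    fun k => (approxCoeff a ξ k).re
  simp only [AddMonoidHom.coe_coe, Complex.ofRealHom_eq_coe, hre, finsum_approxCoeff, hξ] at hsum
  exact_mod_cast hsum

end Symbol

section ApproxMask

variable {α : ℤ →₀ ℝ}

lemma approxMask_two_mul (α : ℤ →₀ ℝ) (ξ : ℝ) (k : ℤ) :
    approxMask α ξ (2 * k) = (approxCoeff (evenPart α) ξ k).re := by
  change (if Even (2 * k) then (approxCoeff (evenPart α) ξ (2 * k / 2)).re else α (2 * k)) = _
  rw [if_pos (even_two_mul k), Int.mul_ediv_cancel_left _ two_ne_zero]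

lemma approxMask_of_odd (α : ℤ →₀ ℝ) (ξ : ℝ) {j : ℤ} (hj : Odd j) : approxMask α ξ j = α j :=
  if_neg (Int.not_even_iff_odd.2 hj)

lemma subdivide_one_even (β : ℤ →₀ ℝ) (m : ℤ) : subdivide β 1 (2 * m) = ∑ᶠ k, β (2 * k) := by
  simp only [subdivide, Pi.one_apply, mul_one, ← mul_sub]
  exact finsum_comp_equiv (Equiv.subLeft m) (f := fun k => β (2 * k))

lemma finsum_evenPart (h1 : subdivide α 1 = 1) : ∑ᶠ k, evenPart α k = 1 :=
  (subdivide_one_even α 0).symm.trans (congrFun h1 (2 * 0))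

lemma eventually_subdivide_approxMask_one (h1 : subdivide α 1 = 1) :
    ∀ᶠ ξ in 𝓝 (0 : ℝ), subdivide (approxMask α ξ) 1 = 1 := by
  filter_upwards [eventually_finsum_re_approxCoeff (finsum_evenPart h1)] with ξ hξ
  ext j
  rcases Int.even_or_odd' j with ⟨m, rfl | rfl⟩
  · simp only [subdivide_one_even, approxMask_two_mul, hξ, Pi.one_apply]
  · rw [← congrFun h1 (2 * m + 1)]
    refine finsum_congr fun k => ?_
    rw [approxMask_of_odd α ξ ⟨m - k, by ring⟩]

lemma two_mul_shiftExp_evenPart_le (α : ℤ →₀ ℝ) : 2 * shiftExp (evenPart α) ≤ shiftExp α := by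
  have hhalf : shiftExp (evenPart α) ≤ shiftExp α / 2 := shiftExp_le_iff.2 fun k hk => by
    have h2k := abs_le_shiftExp (β := α) (i := 2 * k) hk
    rw [abs_mul, abs_two] at h2k
    omega
  omega

lemma shiftExp_approxMask_le (α : ℤ →₀ ℝ) (ξ : ℝ) : shiftExp (approxMask α ξ) ≤ shiftExp α := by
  refine shiftExp_le_iff.2 fun j hj => ?_
  rcases Int.even_or_odd' j with ⟨m, rfl | rfl⟩
  · rw [approxMask_two_mul] at hj
    have hm := abs_le_shiftExp_of_approxCoeff_ne_zero (ne_of_apply_ne Complex.re hj)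
    have := two_mul_shiftExp_evenPart_le α
    rw [abs_mul, abs_two]
    omega
  · rw [approxMask_of_odd α ξ (odd_two_mul_add_one m)] at hj
    exact abs_le_shiftExp hj

lemma tendsto_approxMask (h1 : subdivide α 1 = 1) :
    Tendsto (fun ξ : ℝ => ⇑(approxMask α ξ)) (𝓝 0) (𝓝 α) := by
  refine tendsto_pi_nhds.2 fun j => ?_
  rcases Int.even_or_odd' j with ⟨m, rfl | rfl⟩
  · simp only [approxMask_two_mul]
    exact (Complex.continuous_re.tendsto _).comp (tendsto_approxCoeff (finsum_evenPart h1) m)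
  · simp only [approxMask_of_odd α _ (odd_two_mul_add_one m)]
    exact tendsto_const_nhds

end ApproxMask

end Subdivision

open Subdivision Filter Topology in
theorem mainTheorem9_general (α : ℤ →₀ ℝ) (hα : IsConvergent α) :
    ∀ᶠ ξ in 𝓝 (0 : ℝ), IsConvergent (approxMask α ξ) := by
  obtain ⟨c, f, hf, hf₀⟩ := hα.2
  have h1 : subdivide α 1 = 1 := hf.subdivide_one hf₀
  exact hα.eventually_of_tendsto (.of_forall (shiftExp_approxMask_le α)) (tendsto_approxMask h1)
    (eventually_subdivide_approxMask_one h1)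

theorem mainTheorem9 (α : ℤ →₀ ℝ) (hα : Subdivision.IsConvergent α) :
    ∃ ξ₀ : ℝ, 0 < ξ₀ ∧ ∀ ξ : ℝ, 0 < ξ → ξ < ξ₀ →
      Subdivision.IsConvergent (Subdivision.approxMask α ξ) := by
  obtain ⟨ξ₀, hξ₀, h⟩ := Metric.eventually_nhds_iff.1 (mainTheorem9_general α hα)
  exact ⟨ξ₀, hξ₀, fun ξ hξ hlt => h (by rwa [Real.dist_0_eq_abs, abs_of_pos hξ])⟩
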